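/- An edge-coloring of a finite graph $G$ is a map $c:E(G)\to\mathbb N$ (not necessarily proper). A subgraph is rainbow if its edges have pairwise different colors. Let $\mathrm{ar}(G,H)$ be the maximum number of colors in an edge-coloring of $G$ without a rainbow copy of $H$, and let $\mathrm{ex}(G,H)$ be the maximum number of edges in a subgraph of $G$ without a copy of $H$. Let $K_r^t$ be the complete $r$-partite graph with all partite sets $U_1,\dots,U_r$ of size $t$, where $U_i=\{u_i^1,\dots,u_i^t\}$; let $K_r$ have vertices $v_1,\dots,v_r$; and let $T_{r,m}$ be the Turán graph, i.e. the complete $m$-partite graph on $r$ vertices whose part sizes pairwise differ by at most one. A color $a$ of an edge-coloring of $K_r$ is saturated by $v$ if $a$ occurs and every edge of color $a$ is incident to $v$. The blow-up of an edge-coloring $c$ of $K_r$ is the following coloring of $K_r^t$ (determined up to renaming colors). For an edge $u_i^su_j^{s'}$ with $a=c(v_iv_j)$: if $a$ is saturated by no vertex, the edge receives color $a$; if $a$ is saturated by exactly one vertex, say $v_i$, it receives a color $a_s$; if $a$ is saturated by both $v_i$ and $v_j$, it receives a color $a_{s,s'}$. Here all the colors $a$, $a_s$, $a_{s,s'}$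 arising in this way are distinct. Theorem. For all integers $r\ge k\ge 4$ and $t\ge 1$, $$\mathrm{ar}(K_r^t,K_k)=\begin{cases} t^2\left(\binom k2-2\right)+t, & r=k,\\ t^2\,\mathrm{ex}(K_r,K_{k-1})+1, & r>k.\end{cases}$$ Moreover, when $r>k$ the value is attained by the blow-up of the Turán coloring: if an edge-coloring of $K_r$ has a rainbow spanning subgraph $T\cong T_{r,k-2}$ and gives all edges of $K_r$ outside $T$ one common color not used on $T$ (such colorings exist), then its blow-up is an edge-coloring of $K_r^t$ with no rainbow $K_k$ and with exactly $t^2\,\mathrm{ex}(K_r,K_{k-1})+1$ colors. -/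

import Mathlib

namespace AntiRamsey

open SimpleGraph

variable {V W C : Type*}

/-- The number of colors that an edge-coloring uses. -/
noncomputable def numColors {G : SimpleGraph V} (c : G.EdgeLabeling C) : ℕ :=
  (Set.range c).ncard

/-- The edge-colored graph `G` contains a copy of `H` whose edges have pairwise distinct colors. -/
def HasRainbowCopy {G : SimpleGraph V} (c : G.EdgeLabeling C) (H : SimpleGraph W) : Prop :=
  ∃ f : H.Copy G, Function.Injective (c.pullback f.toHom)

/-- The anti-Ramsey number `ar(G, H)`: the maximum number of colors in an edge-coloring
`E(G) → ℕ` without a rainbow copy of `H`. For finite `G` the set is bounded, so that a nonzero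
value of this supremum is a maximum. -/
noncomputable def antiRamseyNumber (G : SimpleGraph V) (H : SimpleGraph W) : ℕ :=
  sSup {n : ℕ | ∃ c : G.EdgeLabeling ℕ, ¬ HasRainbowCopy c H ∧ numColors c = n}

/-- The color `a` is saturated by `v`: it appears, and every edge of color `a` is incident
to `v`. -/
def Saturates {G : SimpleGraph V} (c : G.EdgeLabeling C) (v : V) (a : C) : Prop :=
  (∃ e, c e = a) ∧ ∀ e : G.edgeSet, c e = a → v ∈ (e : Sym2 V)

/-- The blow-up of a graph in which every vertex `v` is replaced by the `t` independent vertices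
`(v, s)`. The blow-up of the complete graph on `Fin r` is `completeEquipartiteGraph r t`. -/
abbrev blowUp (G : SimpleGraph V) (t : ℕ) : SimpleGraph (V × Fin t) :=
  G.comap Prod.fst

/-- The projection of a blow-up to the original graph. -/
def blowUpProj (G : SimpleGraph V) (t : ℕ) : blowUp G t →g G where
  toFun := Prod.fst
  map_rel' h := h

/-- The blow-up of an edge-coloring. An edge over an edge of color `a` receives the color `a`
together with the set of those of its ends that lie over a vertex saturating `a`. Thus a color
saturated by no vertex is kept, a color `b` saturated by exactly one vertex `v` is split into the
`t` colors `(b, {(v, s)})`, and a color saturated by two vertices `v`, `w` (the color of the single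
edge `vw`) is split into the `t ^ 2` colors `(b, {(v, s), (w, s')})`. -/
def blowUpColoring {G : SimpleGraph V} (c : G.EdgeLabeling C) (t : ℕ) :
    (blowUp G t).EdgeLabeling (C × Set (V × Fin t)) :=
  fun e => (c.pullback (blowUpProj G t) e,
    {u | u ∈ (e : Sym2 (V × Fin t)) ∧ Saturates c u.1 (c.pullback (blowUpProj G t) e)})

/-- A Turán coloring of `K_r` with `m` parts: there is a rainbow copy `T` of the Turán graph
`T_{r,m}`, and the edges outside `T` are exactly those having one extra common color. -/
def IsTuranColoring {r : ℕ} (m : ℕ) (c : (completeGraph (Fin r)).EdgeLabeling C) : Prop :=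
  ∃ T : SimpleGraph (Fin r), Nonempty (T ≃g turanGraph r m) ∧
    (∀ e e' : (completeGraph (Fin r)).edgeSet, (e : Sym2 (Fin r)) ∈ T.edgeSet →
      (e' : Sym2 (Fin r)) ∈ T.edgeSet → c e = c e' → e = e') ∧
    ∃ a : C, ∀ e : (completeGraph (Fin r)).edgeSet, c e = a ↔ (e : Sym2 (Fin r)) ∉ T.edgeSet

end AntiRamsey

/-!
Given a coloring of the blow-up of `G` and a transversal of the parts, one gets a coloring of `G`,
and a rainbow copy of `H` there is one in the blow-up. Averaging over all transversals shows that
some transversal gives a coloring of `G` whose blow-up has at least as many colors as the coloring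
we started from. Conversely, a rainbow complete graph in the blow-up of a coloring projects to one
in `G`. Hence, for complete `H`, the anti-Ramsey number of the blow-up is the maximum, over the
colorings of `G` without a rainbow copy, of the sum of `t ^ s(a)` over the colors `a`, where
`s(a) ≤ 2` is the number of vertices saturating `a`.

For `K_r` with `r = k` this sum is maximal when exactly two adjacent edges share a color. For
`r > k`, the clique anti-Ramsey theorem allows at most `ex(K_r, K_{k-1}) + 1` colors. If two of
them have `s(a) ≤ 1`, then `2 * t ≤ t ^ 2 + 1` gives the bound. Otherwise all edges but those of a
single color have their own color, and unless that color has `s(a) = 0`, deleting a vertex that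
saturates it leaves a rainbow `K_{r-1}`.

The clique anti-Ramsey theorem is an induction on the number of vertices: a vertex whose star
contributes few new colors is deleted, and if there is none, then a rainbow clique is chosen
greedily, since every vertex has many neighbors along edges of private colors.
-/

namespace AntiRamsey

open SimpleGraph Finset

theorem dvd_card_of_disjoint_blocks {V : Type*} {A : Finset V} {q : ℕ} {B : V → Finset V}
    (hsub : ∀ v ∈ A, B v ⊆ A) (hmem : ∀ v ∈ A, v ∈ B v) (hcard : ∀ v ∈ A, #(B v) = q)
    (hdisj : ∀ v ∈ A, ∀ w ∈ A, w ∉ B v → Disjoint (B v) (B w)) : q ∣ #A := by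
  classical
  induction A using Finset.strongInduction with
  | H A ih =>
    obtain rfl | ⟨v, hv⟩ := A.eq_empty_or_nonempty
    · simp
    have hrest : q ∣ #(A \ B v) := by
      refine ih _ (sdiff_ssubset (hsub v hv) ⟨v, hmem v hv⟩) (fun w hw => ?_)
        (fun w hw => hmem w (sdiff_subset hw)) (fun w hw => hcard w (sdiff_subset hw))
        (fun w hw u hu => hdisj w (sdiff_subset hw) u (sdiff_subset hu))
      obtain ⟨hwA, hwv⟩ := mem_sdiff.1 hw
      exact subset_sdiff.2 ⟨hsub w hwA, (hdisj v hv w hwA hwv).symm⟩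
    rw [← card_sdiff_add_card_eq_card (hsub v hv), hcard v hv]
    exact hrest.add (dvd_refl q)

section CompleteGraphs

variable {V C : Type*} [DecidableEq V] {c : Sym2 V → C} {A X K R : Finset V} {v : V} {n : ℕ}

/-- The unordered pairs of distinct elements of `A`, that is, the edges of the complete graph
on `A`. -/
def pairs (A : Finset V) : Finset (Sym2 V) := {e ∈ A.sym2 | ¬ e.IsDiag}

theorem mk_mem_pairs {x y : V} : s(x, y) ∈ pairs A ↔ x ∈ A ∧ y ∈ A ∧ x ≠ y := by
  simp [pairs, and_assoc]

theorem coe_pairs_univ [Fintype V] :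
    ((pairs univ : Finset (Sym2 V)) : Set (Sym2 V)) = (completeGraph V).edgeSet := by
  ext e
  induction e with | _ x y => simp [mk_mem_pairs]

theorem card_pairs (A : Finset V) : #(pairs A) = (#A).choose 2 := by
  rw [pairs, sym2_eq_image, Sym2.filter_image_mk_not_isDiag, Sym2.card_image_offDiag]

theorem pairs_mono (h : A ⊆ X) : pairs A ⊆ pairs X :=
  filter_subset_filter _ (sym2_mono h)

theorem pairs_insert (hv : v ∉ A) : pairs (insert v A) = pairs A ∪ A.image (s(v, ·)) := by
  ext e
  induction e with | _ x y =>
  simp only [mem_union, mk_mem_pairs, mem_image, mem_insert, Sym2.eq_iff]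
  grind

/-- The colors that `c` uses on the complete graph on `A`. The values of `c` on the diagonal play
no role. -/
def colorsOn [DecidableEq C] (c : Sym2 V → C) (A : Finset V) : Finset C := (pairs A).image c

theorem card_colorsOn_le [DecidableEq C] (c : Sym2 V → C) (A : Finset V) :
    #(colorsOn c A) ≤ (#A).choose 2 :=
  card_image_le.trans (card_pairs A).le

/-- Some `n` vertices of `X` span a rainbow complete graph. -/
def HasRainbowClique (c : Sym2 V → C) (X : Finset V) (n : ℕ) : Prop :=
  ∃ K ⊆ X, #K = n ∧ Set.InjOn c (pairs K)

theorem HasRainbowClique.mono (h : HasRainbowClique c A n) (hAX : A ⊆ X) :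
    HasRainbowClique c X n :=
  let ⟨K, hK, hn, hinj⟩ := h
  ⟨K, hK.trans hAX, hn, hinj⟩

theorem hasRainbowClique_two (hX : 2 ≤ #X) : HasRainbowClique c X 2 := by
  obtain ⟨K, hKX, hK⟩ := exists_subset_card_eq hX
  have hcard : #(pairs K) ≤ 1 := by rw [card_pairs, hK, Nat.choose_self]
  exact ⟨K, hKX, hK, fun e he e' he' _ => card_le_one.1 hcard e he e' he'⟩

/-- The edges from `v` to `R` have pairwise distinct colors, and none of these colors occurs on
the complete graph on `A.erase v`. -/
structure IsPrivateStar (c : Sym2 V → C) (A : Finset V) (v : V) (R : Finset V) : Prop where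
  subset : R ⊆ A.erase v
  injOn : Set.InjOn (fun x => c s(v, x)) R
  ne : ∀ x ∈ R, ∀ e ∈ pairs (A.erase v), c e ≠ c s(v, x)

theorem IsPrivateStar.injOn_pairs_insert (hR : IsPrivateStar c A v R) (hKR : K ⊆ R)
    (hK : Set.InjOn c (pairs K)) : Set.InjOn c (pairs (insert v K)) := by
  have hKA : K ⊆ A.erase v := hKR.trans hR.subset
  have hsep : ∀ e ∈ pairs K, ∀ x ∈ K, c e ≠ c s(v, x) := fun e he x hx =>
    hR.ne x (hKR hx) e (pairs_mono hKA he)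
  rw [pairs_insert fun hv => notMem_erase v A (hKA hv), coe_union, coe_image]
  have hdisj : Disjoint (pairs K : Set (Sym2 V)) ((s(v, ·)) '' K) := by
    refine Set.disjoint_left.2 ?_
    rintro e he ⟨x, hx, rfl⟩
    exact hsep _ he x hx rfl
  refine (Set.injOn_union hdisj).2 ⟨hK, (hR.injOn.mono hKR).image_of_comp, ?_⟩
  rintro e he _ ⟨x, hx, rfl⟩
  exact hsep e he x hx

theorem IsPrivateStar.hasRainbowClique_succ (hR : IsPrivateStar c A v R) (hv : v ∈ X)
    (h : HasRainbowClique c (X ∩ R) n) : HasRainbowClique c X (n + 1) := by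
  obtain ⟨K, hK, rfl, hinj⟩ := h
  have hKR : K ⊆ R := hK.trans inter_subset_right
  refine ⟨insert v K, insert_subset hv (hK.trans inter_subset_left), ?_,
    hR.injOn_pairs_insert hKR hinj⟩
  exact card_insert_of_notMem fun hvK => notMem_erase v A (hR.subset (hKR hvK))

theorem exists_isPrivateStar [DecidableEq C] (c : Sym2 V → C) (hv : v ∈ A) :
    ∃ R, IsPrivateStar c A v R ∧ #(colorsOn c A) ≤ #R + #(colorsOn c (A.erase v)) := by
  have hcolors : colorsOn c A =
      colorsOn c (A.erase v) ∪ (A.erase v).image fun x => c s(v, x) := by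
    rw [colorsOn, colorsOn, ← insert_erase hv, pairs_insert (notMem_erase v A),
      erase_insert (notMem_erase v A), image_union, image_image]
    rfl
  obtain ⟨R, hRA, hinj, himage⟩ := exists_subset_injOn_image_eq_of_surjOn
    (A.erase v : Set V) (colorsOn c A \ colorsOn c (A.erase v)) (f := fun x => c s(v, x))
    fun a ha => by
      rw [hcolors, union_sdiff_left, mem_coe] at ha
      exact_mod_cast (mem_sdiff.1 ha).1
  refine ⟨R, ⟨coe_subset.1 hRA, hinj, fun x hx e he hex => ?_⟩, ?_⟩
  · have hnew := himage ▸ mem_image_of_mem (fun x => c s(v, x)) hx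
    exact (mem_sdiff.1 hnew).2 (hex ▸ mem_image_of_mem c he)
  · rw [← card_image_of_injOn hinj, himage]
    exact tsub_le_iff_right.1 (le_card_sdiff _ _)

section Greedy

variable {Q : V → Finset V} {m q j : ℕ}

theorem card_le_card_inter_add_card_sdiff (hXA : X ⊆ A) (R : Finset V) :
    #X ≤ #(X ∩ R) + #(A \ R) := by
  rw [← card_inter_add_card_sdiff X R]
  gcongr

theorem hasRainbowClique_of_mul_add_two_le (hQ : ∀ v ∈ A, IsPrivateStar c A v (Q v))
    (hq : ∀ v ∈ A, #(A \ Q v) ≤ q) (hXA : X ⊆ A) (hX : j * q + 2 ≤ #X) :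
    HasRainbowClique c X (j + 2) := by
  induction j generalizing X with
  | zero => exact hasRainbowClique_two (by omega)
  | succ j ih =>
    obtain ⟨v, hv⟩ : X.Nonempty := card_pos.1 (by omega)
    have hcard := card_le_card_inter_add_card_sdiff hXA (Q v)
    have hqv := hq v (hXA hv)
    rw [add_one_mul] at hX
    exact (hQ v (hXA hv)).hasRainbowClique_succ hv (ih (inter_subset_left.trans hXA) (by omega))

theorem hasRainbowClique_of_card_sdiff_lt (hQ : ∀ v ∈ A, IsPrivateStar c A v (Q v))
    (hq : ∀ v ∈ A, #(A \ Q v) ≤ q) (hv : v ∈ A) (hlt : #(A \ Q v) < q)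
    (hA : (j + 1) * q + 1 ≤ #A) : HasRainbowClique c A (j + 3) := by
  have hcard := card_le_card_inter_add_card_sdiff Subset.rfl (A := A) (Q v)
  rw [add_one_mul] at hA
  exact (hQ v hv).hasRainbowClique_succ hv
    (hasRainbowClique_of_mul_add_two_le hQ hq inter_subset_left (by omega))

theorem hasRainbowClique_of_not_disjoint (hQ : ∀ v ∈ A, IsPrivateStar c A v (Q v))
    (hq : ∀ v ∈ A, #(A \ Q v) ≤ q) (hv : v ∈ A) {w : V} (hw : w ∈ A) (hwv : w ∈ Q v)
    (hmeet : ¬ Disjoint (A \ Q v) (A \ Q w)) (hA : (j + 2) * q + 1 ≤ #A) :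
    HasRainbowClique c A (j + 4) := by
  have hcard := card_le_card_inter_add_card_sdiff Subset.rfl (A := A) (Q v ∩ Q w)
  have hmeet : 0 < #(A \ Q v ∩ (A \ Q w)) := card_pos.2 (not_disjoint_iff_nonempty_inter.1 hmeet)
  have hunion := card_union_add_card_inter (A \ Q v) (A \ Q w)
  rw [← sdiff_inter_distrib_right] at hunion
  have hqv := hq v hv
  have hqw := hq w hw
  rw [add_mul] at hA
  refine (hQ v hv).hasRainbowClique_succ hv ((hQ w hw).hasRainbowClique_succ
    (mem_inter.2 ⟨hw, hwv⟩) (hasRainbowClique_of_mul_add_two_le hQ hq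
      (inter_subset_left.trans inter_subset_left) ?_))
  rw [inter_assoc]
  omega

theorem hasRainbowClique_of_mul_add_one_le (hm : 2 ≤ m)
    (hQ : ∀ v ∈ A, IsPrivateStar c A v (Q v)) (hq : ∀ v ∈ A, #(A \ Q v) ≤ q)
    (hA : m + 2 ≤ #A) (hAq : m * q + 1 ≤ #A) : HasRainbowClique c A (m + 2) := by
  obtain ⟨j, rfl⟩ := Nat.exists_eq_add_of_le' hm
  by_contra hno
  have hAq : #A = (j + 2) * q + 1 := by
    by_contra hne
    exact hno (hasRainbowClique_of_mul_add_two_le hQ hq Subset.rfl (by omega))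
  have hcard : ∀ v ∈ A, #(A \ Q v) = q := fun v hv => (hq v hv).eq_of_not_lt fun hlt =>
    hno (hasRainbowClique_of_card_sdiff_lt hQ hq hv hlt hAq.ge)
  have hdisj : ∀ v ∈ A, ∀ w ∈ A, w ∉ A \ Q v → Disjoint (A \ Q v) (A \ Q w) := by
    intro v hv w hw hwv
    by_contra hmeet
    have hwQ : w ∈ Q v := by simpa [hw] using hwv
    exact hno (hasRainbowClique_of_not_disjoint hQ hq hv hw hwQ hmeet hAq.ge)
  -- In this extremal case the sets `A \ Q v` partition `A` into blocks of size `q`.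
  have hdvd : q ∣ (j + 2) * q + 1 := hAq ▸ dvd_card_of_disjoint_blocks (fun _ _ => sdiff_subset)
    (fun v hv => mem_sdiff.2 ⟨hv, fun h => notMem_erase v A ((hQ v hv).subset h)⟩) hcard hdisj
  obtain rfl : q = 1 := Nat.dvd_one.1 ((Nat.dvd_add_right (dvd_mul_left q _)).1 hdvd)
  omega

end Greedy

theorem card_edgeFinset_turanGraph_of_le {m n : ℕ} (h : n ≤ m) :
    #(turanGraph n m).edgeFinset = n.choose 2 := by
  have htop := card_edgeFinset_top_eq_card_choose_two (V := Fin n)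
  rw [Fintype.card_fin] at htop
  rw [← htop]
  congr!
  exact turanGraph_eq_top.2 (.inr h)

theorem card_edgeFinset_turanGraph_succ {m : ℕ} (hm : 0 < m) (n : ℕ) :
    #(turanGraph (n + 1) m).edgeFinset = #(turanGraph n m).edgeFinset + (n - n / m) := by
  induction n using Nat.strong_induction_on with | _ n ih =>
  obtain hlt | hle := lt_or_ge n m
  · rw [card_edgeFinset_turanGraph_of_le hlt, card_edgeFinset_turanGraph_of_le hlt.le,
      Nat.div_eq_of_lt hlt, Nat.choose_succ_succ' n 1, Nat.choose_one_right, add_comm, tsub_zero]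
  · obtain ⟨n, rfl⟩ := Nat.exists_eq_add_of_le' hle
    have hdiv := Nat.div_le_self n m
    rw [add_right_comm, card_edgeFinset_turanGraph_add, card_edgeFinset_turanGraph_add,
      ih n (by omega), Nat.add_div_right n hm, add_one_mul]
    omega

theorem choose_two_le_card_edgeFinset_turanGraph {m n : ℕ} (hm : 0 < m) (h : n ≤ m + 1) :
    n.choose 2 ≤ #(turanGraph n m).edgeFinset + 1 := by
  rcases h.lt_or_eq with h | rfl
  · rw [card_edgeFinset_turanGraph_of_le (Nat.lt_succ_iff.1 h)]
    exact Nat.le_succ _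
  · rw [card_edgeFinset_turanGraph_succ hm, card_edgeFinset_turanGraph_of_le le_rfl,
      Nat.choose_succ_succ' m 1, Nat.choose_one_right, one_add_one_eq_two, Nat.div_self hm]
    omega

theorem hasRainbowClique_of_card_turanGraph_add_two_le [DecidableEq C] {m : ℕ} (hm : 2 ≤ m)
    (h : #(turanGraph #A m).edgeFinset + 2 ≤ #(colorsOn c A)) :
    HasRainbowClique c A (m + 2) := by
  induction A using Finset.strongInduction with
  | H A ih =>
  have hmA : m + 2 ≤ #A := by
    by_contra hlt
    have hle := card_colorsOn_le c A
    have hchoose := choose_two_le_card_edgeFinset_turanGraph (m := m) (n := #A)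
      (by omega) (by omega)
    omega
  obtain ⟨n, hn⟩ : ∃ n, #A = n + 1 := ⟨#A - 1, by omega⟩
  rw [hn, card_edgeFinset_turanGraph_succ (by omega)] at h
  by_cases hdel : ∃ v ∈ A, #(colorsOn c A) ≤ #(colorsOn c (A.erase v)) + (n - n / m)
  · obtain ⟨v, hv, hle⟩ := hdel
    have hcard : #(A.erase v) = n := by rw [card_erase_of_mem hv, hn, Nat.add_sub_cancel]
    exact (ih (A.erase v) (erase_ssubset hv) (by rw [hcard]; omega)).mono (erase_subset v A)
  push Not at hdel
  choose! Q hQ hcard using fun v (hv : v ∈ A) => exists_isPrivateStar c hv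
  refine hasRainbowClique_of_mul_add_one_le (q := n / m) hm hQ (fun v hv => ?_) hmA ?_
  · have hsdiff := card_sdiff_add_card_eq_card ((hQ v hv).subset.trans (erase_subset v A))
    have hlt := hdel v hv
    have hle := hcard v hv
    omega
  · rw [hn]
    exact Nat.succ_le_succ (Nat.mul_div_le n m)

end CompleteGraphs

section RainbowCopies

variable {V V' W C : Type*} {G : SimpleGraph V} {G' : SimpleGraph V'} {H : SimpleGraph W} {n : ℕ}

theorem mapEdgeSet_comp (f : G →g G') (g : H →g G) (e : H.edgeSet) :
    (f.comp g).mapEdgeSet e = f.mapEdgeSet (g.mapEdgeSet e) :=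
  Subtype.ext (Sym2.map_map (g := f) (f := g) e.1).symm

theorem HasRainbowCopy.of_pullback {c : G'.EdgeLabeling C} {f : G →g G'}
    (hf : Function.Injective f) (h : HasRainbowCopy (c.pullback f) H) : HasRainbowCopy c H := by
  obtain ⟨g, hg⟩ := h
  refine ⟨(f.toCopy hf).comp g, fun e e' hee => hg ?_⟩
  change c ((f.comp g.toHom).mapEdgeSet e) = c ((f.comp g.toHom).mapEdgeSet e') at hee
  rwa [mapEdgeSet_comp, mapEdgeSet_comp] at hee

theorem hasRainbowCopy_self_of_injective {c : G.EdgeLabeling C} (hc : Function.Injective c) :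
    HasRainbowCopy c G :=
  ⟨Copy.id G, hc.comp (Copy.id G).mapEdgeSet.injective⟩

theorem HasRainbowCopy.injective [Finite V] {c : G.EdgeLabeling C} (h : HasRainbowCopy c G) :
    Function.Injective c := by
  obtain ⟨f, hf⟩ := h
  have hsurj : Function.Surjective f.mapEdgeSet :=
    Finite.surjective_of_injective f.mapEdgeSet.injective
  exact fun e e' hee => by
    obtain ⟨⟨d, rfl⟩, d', rfl⟩ := hsurj e, hsurj e'
    rw [hf hee]

theorem bddAbove_numColors [Finite V] (G : SimpleGraph V) (H : SimpleGraph W) :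
    BddAbove {n : ℕ | ∃ c : G.EdgeLabeling ℕ, ¬ HasRainbowCopy c H ∧ numColors c = n} := by
  refine ⟨Nat.card G.edgeSet, ?_⟩
  rintro _ ⟨c, -, rfl⟩
  exact Finite.card_range_le (α := G.edgeSet) c

theorem exists_nat_coloring_numColors_eq [Finite V] {c : G.EdgeLabeling C}
    (hc : ¬ HasRainbowCopy c H) :
    ∃ c' : G.EdgeLabeling ℕ, ¬ HasRainbowCopy c' H ∧ numColors c' = numColors c := by
  have hfin : (Set.range c).Finite := Set.finite_range (ι := G.edgeSet) c
  obtain ⟨g, hg⟩ := Set.countable_iff_exists_injOn.1 hfin.countable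
  refine ⟨c.compRight g, fun ⟨f, hf⟩ => hc ⟨f, fun e e' hee => hf (congrArg g hee)⟩, ?_⟩
  exact (congrArg Set.ncard (Set.range_comp g c)).trans hg.ncard_image

theorem antiRamseyNumber_eq [Finite V]
    (hub : ∀ c : G.EdgeLabeling ℕ, ¬ HasRainbowCopy c H → numColors c ≤ n)
    (c : G.EdgeLabeling C) (hc : ¬ HasRainbowCopy c H) (hn : numColors c = n) :
    antiRamseyNumber G H = n := by
  obtain ⟨c', hc', hn'⟩ := exists_nat_coloring_numColors_eq hc
  refine le_antisymm (csSup_le ⟨_, c', hc', rfl⟩ ?_)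
    (le_csSup (bddAbove_numColors G H) ⟨c', hc', hn'.trans hn⟩)
  rintro _ ⟨c, hc, rfl⟩
  exact hub c hc

/-- The colors that an edge-coloring of a finite graph uses. -/
noncomputable def colors [Finite V] (c : G.EdgeLabeling C) : Finset C :=
  (Set.finite_range (ι := G.edgeSet) c).toFinset

theorem mem_colors [Finite V] {c : G.EdgeLabeling C} {a : C} : a ∈ colors c ↔ ∃ e, c e = a :=
  Set.Finite.mem_toFinset _

theorem apply_mem_colors [Finite V] {c : G.EdgeLabeling C} (e : G.edgeSet) : c e ∈ colors c :=
  mem_colors.2 ⟨e, rfl⟩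

theorem card_colors [Finite V] (c : G.EdgeLabeling C) : #(colors c) = numColors c :=
  (Set.ncard_eq_toFinset_card _ _).symm

/-- The vertices of a finite graph that saturate a color. -/
noncomputable def saturators [Finite V] (c : G.EdgeLabeling C) (a : C) : Finset V :=
  (Set.toFinite {v | Saturates c v a}).toFinset

theorem mem_saturators [Finite V] {c : G.EdgeLabeling C} {a : C} {v : V} :
    v ∈ saturators c a ↔ Saturates c v a :=
  Set.Finite.mem_toFinset _

theorem coe_saturators [Finite V] (c : G.EdgeLabeling C) (a : C) :
    (saturators c a : Set V) = {v | Saturates c v a} :=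
  Set.Finite.coe_toFinset _

end RainbowCopies

theorem ncard_range_graphOn {α β : Type*} [Fintype β] [Nonempty β] (s : Finset α) :
    (Set.range fun φ : α → β => (s : Set α).graphOn φ).ncard = Fintype.card β ^ #s := by
  classical
  have hrestrict : Function.Surjective fun (φ : α → β) (i : s) => φ i :=
    Subtype.val_injective.surjective_comp_right
  have hfactor : (fun φ : α → β => (s : Set α).graphOn φ) =
      (fun ψ : s → β => (s : Set α).graphOn (Function.surjInv hrestrict ψ)) ∘
        fun φ i => φ i := by
    funext φ
    refine Set.graphOn_inj.2 fun i hi => ?_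
    exact (congrFun (Function.surjInv_eq hrestrict fun i : s => φ i) ⟨i, hi⟩).symm
  have hinj : Function.Injective
      fun ψ : s → β => (s : Set α).graphOn (Function.surjInv hrestrict ψ) := by
    intro ψ ψ' h
    rw [← Function.surjInv_eq hrestrict ψ, ← Function.surjInv_eq hrestrict ψ']
    exact funext fun i => Set.graphOn_inj.1 h i.2
  rw [hfactor, hrestrict.range_comp, ← Nat.card_coe_set_eq, Nat.card_range_of_injective hinj]
  simp

/-- Every function `θ` agrees off `S φ` with the element `φ` of `P` closest to it, so `P` has to be
large where `S` is small. -/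
theorem prod_card_le_sum_prod_card {ι : Type*} {α : ι → Type*} [Fintype ι] [DecidableEq ι]
    [∀ i, Fintype (α i)] {P : Finset (∀ i, α i)} (hP : P.Nonempty)
    {S : (∀ i, α i) → Finset ι}
    (hS : ∀ φ ∈ P, ∀ i ∉ S φ, ∀ s, Function.update φ i s ∈ P) :
    ∏ i, Fintype.card (α i) ≤ ∑ φ ∈ P, ∏ i ∈ S φ, Fintype.card (α i) := by
  classical
  have hcover : univ ⊆ P.biUnion fun φ =>
      Fintype.piFinset fun i => if i ∈ S φ then univ else {φ i} := by
    intro θ _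
    obtain ⟨φ, hφ, hmin⟩ := P.exists_min_image (hammingDist · θ) hP
    refine mem_biUnion.2 ⟨φ, hφ, Fintype.mem_piFinset.2 fun i => ?_⟩
    split_ifs with hi
    · exact mem_univ _
    by_contra hne
    refine (hmin _ (hS φ hφ i hi (θ i))).not_gt (card_lt_card ((ssubset_iff_of_subset ?_).2
      ⟨i, by simpa [eq_comm] using hne, by simp⟩))
    intro j
    obtain rfl | hij := eq_or_ne j i <;> simp_all
  calc ∏ i, Fintype.card (α i) = #(univ : Finset (∀ i, α i)) := by rw [card_univ, Fintype.card_pi]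
    _ ≤ _ := card_le_card hcover
    _ ≤ _ := card_biUnion_le
    _ = _ := sum_congr rfl fun φ _ => by
      rw [Fintype.card_piFinset, ← prod_subset (subset_univ (S φ)) fun i _ hi => by simp [hi]]
      exact prod_congr rfl fun i hi => by simp [hi]

section BlowUp

variable {V W C : Type*} {G : SimpleGraph V} {t : ℕ}

/-- The copy of `G` in its blow-up that contains the vertex `(v, φ v)` for each `v`. -/
def transversal (G : SimpleGraph V) (φ : V → Fin t) : G →g blowUp G t where
  toFun v := (v, φ v)
  map_rel' h := h

theorem transversal_injective (φ : V → Fin t) : Function.Injective (transversal G φ) :=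
  fun _ _ h => congrArg Prod.fst h

theorem exists_mapEdgeSet_transversal_eq (e : (blowUp G t).edgeSet) :
    ∃ (φ : V → Fin t) (d : G.edgeSet), (transversal G φ).mapEdgeSet d = e := by
  classical
  obtain ⟨e, he⟩ := e
  induction e with | _ x y =>
  have hadj : G.Adj x.1 y.1 := he
  refine ⟨Function.update (fun _ => y.2) x.1 x.2, ⟨s(x.1, y.1), hadj⟩, Subtype.ext ?_⟩
  change s((x.1, _), (y.1, _)) = s(x, y)
  rw [Function.update_self, Function.update_of_ne hadj.ne']

theorem pullback_transversal_eq {c : (blowUp G t).EdgeLabeling C} {φ ψ : V → Fin t}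
    {e : G.edgeSet} (h : ∀ v ∈ (e : Sym2 V), φ v = ψ v) :
    c.pullback (transversal G φ) e = c.pullback (transversal G ψ) e :=
  congrArg c (Subtype.ext (Sym2.map_congr fun v hv => Prod.ext rfl (h v hv)))

theorem blowUpColoring_transversal (c : G.EdgeLabeling C) (φ : V → Fin t) (e : G.edgeSet) :
    blowUpColoring c t ((transversal G φ).mapEdgeSet e) =
      (c e, {v | Saturates c v (c e)}.graphOn φ) := by
  have hproj : (blowUpProj G t).mapEdgeSet ((transversal G φ).mapEdgeSet e) = e :=
    (mapEdgeSet_comp _ _ e).symm.trans (Subtype.ext (congrFun Sym2.map_id _))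
  have hc : c.pullback (blowUpProj G t) ((transversal G φ).mapEdgeSet e) = c e := congrArg c hproj
  refine Prod.ext hc (Set.ext fun u => ?_)
  simp only [blowUpColoring, hc, Set.mem_ofPred_eq, Set.mem_graphOn]
  constructor
  · rintro ⟨hu, hsat⟩
    obtain ⟨v, -, rfl⟩ := Sym2.mem_map.1 hu
    exact ⟨hsat, rfl⟩
  · rintro ⟨hsat, hu⟩
    exact ⟨Sym2.mem_map.2 ⟨u.1, hsat.2 e rfl, Prod.ext rfl hu⟩, hsat⟩

theorem mem_range_blowUpColoring {c : G.EdgeLabeling C} {p : C × Set (V × Fin t)} :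
    p ∈ Set.range (blowUpColoring c t) ↔
      ∃ (φ : V → Fin t) (e : G.edgeSet), (c e, {v | Saturates c v (c e)}.graphOn φ) = p := by
  constructor
  · rintro ⟨e, rfl⟩
    obtain ⟨φ, d, rfl⟩ := exists_mapEdgeSet_transversal_eq e
    exact ⟨φ, d, (blowUpColoring_transversal c φ d).symm⟩
  · rintro ⟨φ, e, rfl⟩
    exact ⟨_, blowUpColoring_transversal c φ e⟩

theorem numColors_blowUpColoring [Finite V] [NeZero t] (c : G.EdgeLabeling C) :
    numColors (blowUpColoring c t) = ∑ a ∈ colors c, t ^ #(saturators c a) := by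
  classical
  have hmaps : ∀ p ∈ colors (blowUpColoring c t), p.1 ∈ colors c := by
    intro p hp
    obtain ⟨φ, e, rfl⟩ := mem_range_blowUpColoring.1 (mem_colors.1 hp)
    exact apply_mem_colors e
  rw [← card_colors, card_eq_sum_card_fiberwise hmaps]
  refine sum_congr rfl fun a ha => ?_
  obtain ⟨e, rfl⟩ := mem_colors.1 ha
  have hfiber : ({p ∈ colors (blowUpColoring c t) | p.1 = c e} : Finset _) = Prod.mk (c e) ''
      Set.range fun φ : V → Fin t => (saturators c (c e) : Set V).graphOn φ := by
    ext p
    rw [mem_coe, mem_filter, mem_colors, ← Set.mem_range (f := blowUpColoring c t),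
      mem_range_blowUpColoring]
    constructor
    · rintro ⟨⟨φ, d, rfl⟩, hd⟩
      change c d = c e at hd
      exact ⟨_, ⟨φ, rfl⟩, by rw [coe_saturators, hd]⟩
    · rintro ⟨_, ⟨φ, rfl⟩, rfl⟩
      exact ⟨⟨φ, e, by rw [coe_saturators]⟩, rfl⟩
  rw [← Set.ncard_coe_finset, hfiber, Set.ncard_image_of_injective _ (Prod.mk_right_injective _),
    ncard_range_graphOn, Fintype.card_fin]

theorem HasRainbowCopy.of_blowUpColoring [NeZero t] {c : G.EdgeLabeling C}
    (h : HasRainbowCopy (blowUpColoring c t) (completeGraph W)) :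
    HasRainbowCopy c (completeGraph W) := by
  obtain ⟨f, hf⟩ := h
  let g : completeGraph W →g G := (blowUpProj G t).comp f.toHom
  have hg : Function.Injective g := Hom.injective_of_top_hom g
  let φ : V → Fin t := Function.extend g (fun w => (f w).2) fun _ => 0
  have hfactor : ∀ e, f.toHom.mapEdgeSet e = (transversal G φ).mapEdgeSet (g.mapEdgeSet e) := by
    refine fun e => .trans (Subtype.ext ?_) (mapEdgeSet_comp _ _ e)
    exact Sym2.map_congr fun w _ =>
      Prod.ext rfl (hg.extend_apply (fun w => (f w).2) (fun _ => 0) w).symm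
  refine ⟨g.toCopy hg, fun e e' hee => hf ?_⟩
  change blowUpColoring c t (f.toHom.mapEdgeSet e) = blowUpColoring c t (f.toHom.mapEdgeSet e')
  have hc : c (g.mapEdgeSet e) = c (g.mapEdgeSet e') := hee
  rw [hfactor, hfactor, blowUpColoring_transversal, blowUpColoring_transversal, hc]

theorem pow_card_le_sum_pow_card_saturators [Fintype V] {c : (blowUp G t).EdgeLabeling C} {a : C}
    (ha : a ∈ colors c) {P : Finset (V → Fin t)}
    (hP : ∀ φ, φ ∈ P ↔ a ∈ colors (c.pullback (transversal G φ))) :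
    t ^ Fintype.card V ≤ ∑ φ ∈ P, t ^ #(saturators (c.pullback (transversal G φ)) a) := by
  classical
  have hne : P.Nonempty := by
    obtain ⟨e, rfl⟩ := mem_colors.1 ha
    obtain ⟨φ, d, rfl⟩ := exists_mapEdgeSet_transversal_eq e
    exact ⟨φ, (hP φ).2 (mem_colors.2 ⟨d, rfl⟩)⟩
  have hupdate : ∀ φ ∈ P, ∀ v ∉ saturators (c.pullback (transversal G φ)) a, ∀ s,
      Function.update φ v s ∈ P := by
    intro φ hφ v hv s
    have hφ := mem_colors.1 ((hP φ).1 hφ)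
    rw [mem_saturators, Saturates, and_iff_right hφ] at hv
    push Not at hv
    obtain ⟨d, hd, hvd⟩ := hv
    refine (hP _).2 (mem_colors.2 ⟨d, .trans (pullback_transversal_eq fun w hw => ?_) hd⟩)
    exact Function.update_of_ne (by rintro rfl; exact hvd hw) _ _
  simpa using prod_card_le_sum_prod_card hne hupdate

theorem exists_numColors_le_numColors_blowUpColoring [Finite V] [NeZero t]
    (c : (blowUp G t).EdgeLabeling C) : ∃ φ : V → Fin t,
      numColors c ≤ numColors (blowUpColoring (c.pullback (transversal G φ)) t) := by
  classical
  have := Fintype.ofFinite V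
  suffices ∑ _φ : V → Fin t, numColors c ≤
      ∑ φ, numColors (blowUpColoring (c.pullback (transversal G φ)) t) by
    obtain ⟨φ, -, hφ⟩ := exists_le_of_sum_le univ_nonempty this
    exact ⟨φ, hφ⟩
  simp only [numColors_blowUpColoring]
  calc ∑ _φ : V → Fin t, numColors c = ∑ _a ∈ colors c, t ^ Fintype.card V := by
        simp [card_colors, mul_comm]
    _ ≤ ∑ a ∈ colors c, ∑ φ with a ∈ colors (c.pullback (transversal G φ)),
          t ^ #(saturators (c.pullback (transversal G φ)) a) :=
        sum_le_sum fun a ha => pow_card_le_sum_pow_card_saturators ha (by simp)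
    _ = _ := by
        refine sum_comm' fun a φ => ?_
        have hsub : a ∈ colors (c.pullback (transversal G φ)) → a ∈ colors c := by
          simp only [mem_colors]
          rintro ⟨e, rfl⟩
          exact ⟨_, rfl⟩
        simpa using hsub

theorem antiRamseyNumber_blowUp_eq [Finite V] [NeZero t] {n : ℕ}
    (hub : ∀ c : G.EdgeLabeling ℕ, ¬ HasRainbowCopy c (completeGraph W) →
      numColors (blowUpColoring c t) ≤ n)
    (c : G.EdgeLabeling C) (hc : ¬ HasRainbowCopy c (completeGraph W))
    (hn : numColors (blowUpColoring c t) = n) :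
    antiRamseyNumber (blowUp G t) (completeGraph W) = n := by
  refine antiRamseyNumber_eq (fun c hc => ?_) _ (fun h => hc h.of_blowUpColoring) hn
  obtain ⟨φ, hφ⟩ := exists_numColors_le_numColors_blowUpColoring c
  exact hφ.trans (hub _ fun h => hc (h.of_pullback (transversal_injective φ)))

end BlowUp

section NumColorsBlowUp

variable {V C : Type*} {G : SimpleGraph V} {t : ℕ} {c : G.EdgeLabeling C}

theorem card_toFinset_edge [DecidableEq V] (e : G.edgeSet) : #(e : Sym2 V).toFinset = 2 :=
  Sym2.card_toFinset_of_not_isDiag _ (G.not_isDiag_of_mem_edgeSet e.2)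

variable [Finite V]

theorem saturators_subset_toFinset [DecidableEq V] (e : G.edgeSet) :
    saturators c (c e) ⊆ (e : Sym2 V).toFinset := fun _ hv =>
  Sym2.mem_toFinset.2 ((mem_saturators.1 hv).2 e rfl)

theorem card_saturators_le_two (e : G.edgeSet) : #(saturators c (c e)) ≤ 2 := by
  classical
  exact (card_le_card (saturators_subset_toFinset e)).trans_eq (card_toFinset_edge e)

theorem card_saturators_eq_two {e : G.edgeSet} (h : ∀ d, c d = c e → d = e) :
    #(saturators c (c e)) = 2 := by
  classical
  rw [← card_toFinset_edge e]
  refine congrArg card ((saturators_subset_toFinset e).antisymm fun v hv => ?_)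
  exact mem_saturators.2 ⟨⟨e, rfl⟩, fun d hd => h d hd ▸ Sym2.mem_toFinset.1 hv⟩

theorem card_saturators_le_one {d e : G.edgeSet} (hne : d ≠ e) (h : c d = c e) :
    #(saturators c (c e)) ≤ 1 := by
  refine card_le_one.2 fun v hv w hw => ?_
  by_contra hvw
  have hends : ∀ d', c d' = c e → (d' : Sym2 V) = s(v, w) := fun d' hd' =>
    (Sym2.mem_and_mem_iff hvw).1
      ⟨(mem_saturators.1 hv).2 d' hd', (mem_saturators.1 hw).2 d' hd'⟩
  exact hne (Subtype.ext ((hends d h).trans (hends e rfl).symm))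

variable [NeZero t]

theorem numColors_blowUpColoring_le (S : Finset C) (hS : S ⊆ colors c) :
    numColors (blowUpColoring c t) ≤
      ∑ a ∈ S, t ^ #(saturators c a) + t ^ 2 * (numColors c - #S) := by
  classical
  have hrest : ∑ a ∈ colors c \ S, t ^ #(saturators c a) ≤ #(colors c \ S) • t ^ 2 := by
    refine sum_le_card_nsmul _ _ _ fun a ha => ?_
    obtain ⟨e, rfl⟩ := mem_colors.1 (mem_sdiff.1 ha).1
    exact Nat.pow_le_pow_right (NeZero.pos t) (card_saturators_le_two e)
  rw [card_sdiff_of_subset hS, card_colors, smul_eq_mul, mul_comm] at hrest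
  rw [numColors_blowUpColoring, ← sum_sdiff hS, add_comm]
  exact Nat.add_le_add_left hrest _

theorem numColors_lt_card_of_not_injective (hc : ¬ Function.Injective c) :
    numColors c < Nat.card G.edgeSet := by
  classical
  have := Fintype.ofFinite G.edgeSet
  have : Finite (Set.range c) := Set.finite_range (ι := G.edgeSet) c
  have := Fintype.ofFinite (Set.range c)
  rw [numColors, ← Nat.card_coe_set_eq, Nat.card_eq_fintype_card, Nat.card_eq_fintype_card]
  refine Fintype.card_lt_of_surjective_not_injective _ Set.rangeFactorization_surjective fun h => ?_
  exact hc (Set.rangeFactorization_injective.1 h)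

theorem numColors_blowUpColoring_le_of_not_injective (hc : ¬ Function.Injective c) :
    numColors (blowUpColoring c t) ≤ t ^ 2 * (Nat.card G.edgeSet - 2) + t := by
  have hlt := numColors_lt_card_of_not_injective hc
  obtain ⟨d, e, hde, hne⟩ := Function.not_injective_iff.1 hc
  have hle := numColors_blowUpColoring_le (t := t) {c e}
    (singleton_subset_iff.2 (apply_mem_colors e))
  rw [sum_singleton, card_singleton, add_comm] at hle
  refine hle.trans (add_le_add ?_ ?_)
  · exact Nat.mul_le_mul_left _ (by omega)
  · exact (Nat.pow_le_pow_right (NeZero.pos t) (card_saturators_le_one hne hde)).trans_eq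
      (pow_one t)

theorem numColors_blowUpColoring_le_of_saturators_eq_empty {N : ℕ} (h : numColors c ≤ N + 1)
    {e : G.edgeSet} (he : saturators c (c e) = ∅) :
    numColors (blowUpColoring c t) ≤ t ^ 2 * N + 1 := by
  have hle := numColors_blowUpColoring_le (t := t) {c e}
    (singleton_subset_iff.2 (apply_mem_colors e))
  rw [sum_singleton, he, card_empty, pow_zero, card_singleton, add_comm] at hle
  exact hle.trans (Nat.succ_le_succ (Nat.mul_le_mul_left _ (by omega)))

theorem numColors_blowUpColoring_le_of_two_repeated {N : ℕ} (h : numColors c ≤ N + 1)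
    {d d' e e' : G.edgeSet} (hd : d ≠ d') (hcd : c d = c d') (he : e ≠ e') (hce : c e = c e')
    (hne : c d' ≠ c e') : numColors (blowUpColoring c t) ≤ t ^ 2 * N + 1 := by
  classical
  have hsub : {c d', c e'} ⊆ colors c := insert_subset_iff.2
    ⟨apply_mem_colors d', singleton_subset_iff.2 (apply_mem_colors e')⟩
  have hle := numColors_blowUpColoring_le (t := t) _ hsub
  have htwo := card_le_card hsub
  rw [card_pair hne, card_colors] at htwo
  obtain ⟨N, rfl⟩ : ∃ N', N = N' + 1 := Nat.exists_eq_succ_of_ne_zero (by omega)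
  calc numColors (blowUpColoring c t)
      ≤ (t ^ #(saturators c (c d')) + t ^ #(saturators c (c e'))) + t ^ 2 * (numColors c - 2) := by
        rwa [sum_pair hne, card_pair hne] at hle
    _ ≤ (t ^ 1 + t ^ 1) + t ^ 2 * N := by
        gcongr ?_ + ?_ + t ^ 2 * ?_
        · exact Nat.pow_le_pow_right (NeZero.pos t) (card_saturators_le_one hd hcd)
        · exact Nat.pow_le_pow_right (NeZero.pos t) (card_saturators_le_one he hce)
        · omega
    _ ≤ t ^ 2 * (N + 1) + 1 := by nlinarith [two_mul_le_add_sq t 1]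

theorem numColors_blowUpColoring_le_or_exists_injOn [Nonempty V] {N : ℕ}
    (h : numColors c ≤ N + 1) :
    numColors (blowUpColoring c t) ≤ t ^ 2 * N + 1 ∨
      ∃ v, Set.InjOn c {e | v ∉ (e : Sym2 V)} := by
  refine or_iff_not_imp_left.2 fun hlt => ?_
  by_cases hinj : Function.Injective c
  · exact ⟨Classical.arbitrary V, hinj.injOn⟩
  obtain ⟨d, d', hcd, hd⟩ := Function.not_injective_iff.1 hinj
  obtain ⟨v, hv⟩ : (saturators c (c d')).Nonempty := nonempty_iff_ne_empty.2 fun hempty =>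
    hlt (numColors_blowUpColoring_le_of_saturators_eq_empty h hempty)
  refine ⟨v, fun e _ e' he' hce => ?_⟩
  by_contra he
  have hcolor : c d' ≠ c e' := fun hc => he' ((mem_saturators.1 hv).2 e' hc.symm)
  exact hlt (numColors_blowUpColoring_le_of_two_repeated h hd hcd he hce hcolor)

theorem numColors_blowUpColoring_of_forall_eq {a : C} (ha : a ∈ colors c)
    (huniq : ∀ d e, c d ≠ a → c d = c e → d = e) :
    numColors (blowUpColoring c t) =
      t ^ 2 * {e | c e ≠ a}.ncard + t ^ #(saturators c a) := by
  classical
  have hcard : #((colors c).erase a) = {e | c e ≠ a}.ncard := by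
    have hinj : Set.InjOn c {e | c e ≠ a} := fun d hd e _ => huniq d e hd
    rw [← hinj.ncard_image, ← Set.ncard_coe_finset]
    congr 1
    ext b
    rw [mem_coe, mem_erase, mem_colors]
    constructor
    · rintro ⟨hb, e, rfl⟩
      exact ⟨e, hb, rfl⟩
    · rintro ⟨e, hb, rfl⟩
      exact ⟨hb, e, rfl⟩
  have htwo : ∀ b ∈ (colors c).erase a, t ^ #(saturators c b) = t ^ 2 := by
    intro b hb
    obtain ⟨hba, hb⟩ := mem_erase.1 hb
    obtain ⟨e, rfl⟩ := mem_colors.1 hb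
    rw [card_saturators_eq_two fun d hd => (huniq e d hba hd.symm).symm]
  rw [numColors_blowUpColoring, ← sum_erase_add _ _ ha, sum_congr rfl htwo, sum_const, hcard,
    smul_eq_mul, mul_comm]

theorem exists_not_injective_numColors_blowUpColoring_eq {e e' : G.edgeSet} (hne : e ≠ e') {v : V}
    (hv : v ∈ (e : Sym2 V)) (hv' : v ∈ (e' : Sym2 V)) :
    ∃ c : G.EdgeLabeling G.edgeSet, ¬ Function.Injective c ∧
      numColors (blowUpColoring c t) = t ^ 2 * (Nat.card G.edgeSet - 2) + t := by
  classical
  let c : G.EdgeLabeling G.edgeSet := fun d => if d = e' then e else d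
  have hce : c e = e := if_neg hne
  have hce' : c e' = e := if_pos rfl
  have hcolor : ∀ d, c d = e ↔ d ∈ ({e, e'} : Set G.edgeSet) := by grind
  have huniq : ∀ d d', c d ≠ e → c d = c d' → d = d' := by grind
  have hsat : #(saturators c e) = 1 := by
    refine le_antisymm ?_ (card_pos.2 ⟨v, mem_saturators.2 ⟨⟨e, hce⟩, fun d hd => ?_⟩⟩)
    · exact hce ▸ card_saturators_le_one hne.symm (hce'.trans hce.symm)
    · obtain rfl | rfl := (hcolor d).1 hd <;> assumption
  have hncard : {d | c d ≠ e}.ncard = Nat.card G.edgeSet - 2 := by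
    simp only [ne_eq, hcolor]
    rw [← Set.ncard_pair hne]
    exact Set.ncard_compl _
  refine ⟨c, fun hinj => hne (hinj (hce.trans hce'.symm)), ?_⟩
  rw [numColors_blowUpColoring_of_forall_eq (mem_colors.2 ⟨e, hce⟩) huniq, hncard, hsat, pow_one]

end NumColorsBlowUp

section CompleteGraphColorings

variable {V W C : Type*}

theorem hasRainbowCopy_completeGraph_of_injOn {c : (completeGraph V).EdgeLabeling C} (f : W ↪ V)
    (hc : Set.InjOn c {e | ∀ v ∈ (e : Sym2 V), v ∈ Set.range f}) :
    HasRainbowCopy c (completeGraph W) := by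
  let g := (Embedding.completeGraph f).toHom
  have hg : Function.Injective g := f.injective
  have hrange : ∀ e, ∀ v ∈ (g.mapEdgeSet e : Sym2 V), v ∈ Set.range f := by
    intro e v hv
    obtain ⟨w, -, rfl⟩ := Sym2.mem_map.1 hv
    exact ⟨w, rfl⟩
  refine (hasRainbowCopy_self_of_injective fun d e hde => ?_).of_pullback hg
  exact Hom.mapEdgeSet.injective g hg (hc (hrange d) (hrange e) hde)

theorem HasRainbowClique.hasRainbowCopy [Fintype V] [DecidableEq V] {c : Sym2 V → C} {n : ℕ}
    (h : HasRainbowClique c univ n) :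
    HasRainbowCopy (G := completeGraph V) (fun e => c e) (completeGraph (Fin n)) := by
  obtain ⟨K, -, hK, hinj⟩ := h
  let f : Fin n ↪ V := (K.equivFinOfCardEq hK).symm.toEmbedding.trans (.subtype _)
  have hpairs : ∀ e : (completeGraph V).edgeSet, (∀ v ∈ (e : Sym2 V), v ∈ Set.range f) →
      (e : Sym2 V) ∈ pairs K := by
    rintro ⟨e, he⟩ hrange
    induction e with | _ x y =>
    obtain ⟨⟨i, rfl⟩, j, rfl⟩ := Sym2.forall_mem_pair.1 hrange
    exact mk_mem_pairs.2 ⟨Subtype.coe_prop _, Subtype.coe_prop _, he⟩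
  exact hasRainbowCopy_completeGraph_of_injOn f fun d hd e he hde =>
    Subtype.ext (hinj (hpairs d hd) (hpairs e he) hde)

theorem numColors_eq_card_colorsOn_univ [Fintype V] [DecidableEq V] [DecidableEq C]
    (c : Sym2 V → C) : numColors (G := completeGraph V) (fun e => c e) = #(colorsOn c univ) := by
  rw [← Set.ncard_coe_finset, colorsOn, coe_image, coe_pairs_univ, Set.image_eq_range]
  rfl

theorem hasRainbowCopy_of_card_turanGraph_add_two_le [Fintype V] {m : ℕ} (hm : 2 ≤ m)
    {c : (completeGraph V).EdgeLabeling C}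
    (h : #(turanGraph (Fintype.card V) m).edgeFinset + 2 ≤ numColors c) :
    HasRainbowCopy c (completeGraph (Fin (m + 2))) := by
  classical
  obtain ⟨_, e₀, rfl⟩ : (Set.range c).Nonempty := by
    refine Set.nonempty_of_ncard_ne_zero (ne_of_gt ?_)
    exact lt_of_lt_of_le (by omega) h
  obtain ⟨d, rfl⟩ : ∃ d : Sym2 V → C, c = fun e : (completeGraph V).edgeSet => d e :=
    ⟨Function.extend Subtype.val c fun _ => c e₀,
      funext fun e => (Subtype.val_injective.extend_apply c _ e).symm⟩
  refine (hasRainbowClique_of_card_turanGraph_add_two_le hm ?_).hasRainbowCopy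
  rwa [card_univ, ← numColors_eq_card_colorsOn_univ]

theorem extremalNumber_completeGraph_fin {m : ℕ} (n : ℕ) (hm : 0 < m) :
    extremalNumber n (completeGraph (Fin (m + 1))) = #(turanGraph n m).edgeFinset := by
  have : Nontrivial (Fin (m + 1)) := Fin.nontrivial_iff_two_le.2 (by omega)
  rw [extremalNumber_top]
  congr!
  simp

theorem card_edgeSet_completeGraph [Fintype V] :
    Nat.card (completeGraph V).edgeSet = (Fintype.card V).choose 2 := by
  classical
  rw [← card_edgeFinset_top_eq_card_choose_two, Nat.card_eq_fintype_card, edgeFinset_card]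

theorem numColors_blowUpColoring_completeGraph_le [Fintype V] {m t : ℕ} [NeZero t] (hm : 2 ≤ m)
    (hV : m + 2 < Fintype.card V) {c : (completeGraph V).EdgeLabeling C}
    (hc : ¬ HasRainbowCopy c (completeGraph (Fin (m + 2)))) :
    numColors (blowUpColoring c t) ≤
      t ^ 2 * extremalNumber (Fintype.card V) (completeGraph (Fin (m + 1))) + 1 := by
  classical
  have : Nonempty V := Fintype.card_pos_iff.1 (by omega)
  have hcolors : numColors c ≤ #(turanGraph (Fintype.card V) m).edgeFinset + 1 := by
    by_contra! hlt
    exact hc (hasRainbowCopy_of_card_turanGraph_add_two_le hm hlt)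
  rw [extremalNumber_completeGraph_fin _ (by omega)]
  refine (numColors_blowUpColoring_le_or_exists_injOn hcolors).resolve_right ?_
  rintro ⟨v, hv⟩
  obtain ⟨f⟩ : Nonempty (Fin (m + 2) ↪ {w // w ≠ v}) := by
    refine Function.Embedding.nonempty_of_card_le ?_
    rw [Fintype.card_fin, Fintype.card_subtype_compl, Fintype.card_subtype_eq]
    omega
  refine hc (hasRainbowCopy_completeGraph_of_injOn (f.trans (.subtype _)) (hv.mono ?_))
  rintro e he hve
  obtain ⟨i, hi⟩ := he v hve
  exact (f i).2 hi

theorem antiRamseyNumber_blowUp_completeGraph_self [Fintype V] {t : ℕ} [NeZero t]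
    (hV : 3 ≤ Fintype.card V) :
    antiRamseyNumber (blowUp (completeGraph V) t) (completeGraph V) =
      t ^ 2 * ((Fintype.card V).choose 2 - 2) + t := by
  classical
  obtain ⟨v, x, y, hvx, hvy, hxy⟩ := Fintype.two_lt_card_iff.1 hV
  obtain ⟨c, hc, hcolors⟩ := exists_not_injective_numColors_blowUpColoring_eq (t := t)
    (G := completeGraph V) (e := ⟨s(v, x), hvx⟩) (e' := ⟨s(v, y), hvy⟩)
    (fun h => hxy (Sym2.congr_right.1 (congrArg Subtype.val h)))
    (Sym2.mem_mk_left v x) (Sym2.mem_mk_left v y)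
  rw [← card_edgeSet_completeGraph]
  refine antiRamseyNumber_blowUp_eq (fun c hc => ?_) c (fun h => hc h.injective) hcolors
  exact numColors_blowUpColoring_le_of_not_injective fun hinj =>
    hc (hasRainbowCopy_self_of_injective hinj)

end CompleteGraphColorings

section TuranColorings

variable {V C : Type*} {m : ℕ}

theorem exists_ne_ne_not_adj_of_cliqueFree [Fintype V] {T : SimpleGraph V} (hT : T.CliqueFree m)
    (hV : m < Fintype.card V) (v : V) : ∃ x y, x ≠ v ∧ y ≠ v ∧ x ≠ y ∧ ¬ T.Adj x y := by
  classical
  obtain ⟨A, hAv, hA⟩ := exists_subset_card_eq (s := univ.erase v) (n := m) (by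
    rw [card_erase_of_mem (mem_univ v), card_univ]
    omega)
  have hnot : ¬ T.IsClique A := fun h => hT A ⟨h, hA⟩
  obtain ⟨⟨x, hx⟩, ⟨y, hy⟩, hxy, hadj⟩ := (not_isClique_iff _).1 hnot
  exact ⟨x, y, ne_of_mem_erase (hAv hx), ne_of_mem_erase (hAv hy),
    fun h => hxy (Subtype.ext h), hadj⟩

theorem exists_isTuranColoring (r m : ℕ) :
    ∃ c : (completeGraph (Fin r)).EdgeLabeling ℕ, IsTuranColoring m c := by
  classical
  obtain ⟨g, hg⟩ := Countable.exists_injective_nat (Sym2 (Fin r))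
  refine ⟨fun e => if (e : Sym2 (Fin r)) ∈ (turanGraph r m).edgeSet then g e + 1 else 0,
    turanGraph r m, ⟨Iso.refl⟩, fun e e' he he' h => ?_, 0, fun e => ?_⟩
  · beta_reduce at h
    rw [if_pos he, if_pos he'] at h
    exact Subtype.ext (hg (Nat.succ_injective h))
  · beta_reduce
    split_ifs with he <;> simp [he]

variable {r t : ℕ} {c : (completeGraph (Fin r)).EdgeLabeling C}

theorem cliqueFree_and_ncard_edgeSet_of_iso_turanGraph (hm : 0 < m) {T : SimpleGraph (Fin r)}
    (hT : Nonempty (T ≃g turanGraph r m)) : T.CliqueFree (m + 1) ∧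
      T.edgeSet.ncard = extremalNumber r (completeGraph (Fin (m + 1))) := by
  classical
  have : Nontrivial (Fin (m + 1)) := Fin.nontrivial_iff_two_le.2 (by omega)
  obtain ⟨hfree, hcard⟩ := card_edgeFinset_eq_extremalNumber_top_iff_nonempty_iso_turanGraph
    (α := Fin (m + 1)) (G := T).2
    (by rwa [Fintype.card_fin, Fintype.card_fin, Nat.add_sub_cancel])
  rw [Fintype.card_fin] at hcard
  refine ⟨by simpa only [Fintype.card_fin] using cliqueFree_iff_top_free.2 hfree, ?_⟩
  rwa [← coe_edgeFinset, Set.ncard_coe_finset]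

theorem IsTuranColoring.not_hasRainbowCopy (hm : 0 < m) (hc : IsTuranColoring m c) :
    ¬ HasRainbowCopy c (completeGraph (Fin (m + 2))) := by
  obtain ⟨T, hT, -, a, ha⟩ := hc
  rintro ⟨f, hf⟩
  have hfree : (T.comap f).CliqueFree (m + 1) :=
    (cliqueFree_and_ncard_edgeSet_of_iso_turanGraph hm hT).1.comap
      ⟨(SimpleGraph.Embedding.comap f.toEmbedding T).toCopy⟩
  obtain ⟨x, y, -, -, hxy, hadj⟩ := exists_ne_ne_not_adj_of_cliqueFree hfree (by simp) 0
  obtain ⟨x', y', hx', hy', hxy', hadj'⟩ := exists_ne_ne_not_adj_of_cliqueFree hfree (by simp) x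
  have hcolor : ∀ u v (huv : u ≠ v), ¬ (T.comap f).Adj u v →
      c.pullback f.toHom ⟨s(u, v), huv⟩ = a := fun u v huv h => (ha _).2 h
  have heq : s(x, y) = s(x', y') := congrArg Subtype.val
    (hf ((hcolor x y hxy hadj).trans (hcolor x' y' hxy' hadj').symm))
  have hx : x ∈ s(x', y') := heq ▸ Sym2.mem_mk_left x y
  exact (Sym2.mem_iff.1 hx).elim hx'.symm hy'.symm

theorem IsTuranColoring.numColors_blowUpColoring [NeZero t] (hm : 0 < m) (hr : m + 1 < r)
    (hc : IsTuranColoring m c) :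
    numColors (blowUpColoring c t) =
      t ^ 2 * extremalNumber r (completeGraph (Fin (m + 1))) + 1 := by
  obtain ⟨T, hT, hinj, a, ha⟩ := hc
  obtain ⟨hfree, hedges⟩ := cliqueFree_and_ncard_edgeSet_of_iso_turanGraph hm hT
  have hcolor : ∀ e, c e ≠ a ↔ (e : Sym2 (Fin r)) ∈ T.edgeSet := fun e => (ha e).not_left
  have havoid : ∀ v, ∃ e, c e = a ∧ v ∉ (e : Sym2 (Fin r)) := by
    intro v
    obtain ⟨x, y, hx, hy, hxy, hadj⟩ := exists_ne_ne_not_adj_of_cliqueFree hfree (by simpa) v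
    exact ⟨⟨s(x, y), hxy⟩, (ha _).2 hadj, by simp [hx.symm, hy.symm]⟩
  have hsat : saturators c a = ∅ := eq_empty_of_forall_notMem fun v hv => by
    obtain ⟨e, he, hve⟩ := havoid v
    exact hve ((mem_saturators.1 hv).2 e he)
  have hmem : a ∈ colors c := by
    obtain ⟨e, he, -⟩ := havoid ⟨0, by omega⟩
    exact mem_colors.2 ⟨e, he⟩
  have hncard : {e | c e ≠ a}.ncard = T.edgeSet.ncard := by
    rw [← Set.ncard_image_of_injective _ Subtype.val_injective]
    congr 1
    ext e
    simp only [Set.mem_image, Set.mem_ofPred_eq, hcolor]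
    exact ⟨fun ⟨_, hd, hde⟩ => hde ▸ hd, fun he => ⟨⟨e, edgeSet_mono le_top he⟩, he, rfl⟩⟩
  rw [numColors_blowUpColoring_of_forall_eq hmem fun d e hd hde =>
    hinj d e ((hcolor d).1 hd) ((hcolor e).1 (hde ▸ hd)) hde, hncard, hedges, hsat, card_empty,
    pow_zero]

theorem antiRamseyNumber_blowUp_completeGraph_of_lt [NeZero t] (hm : 2 ≤ m) (hr : m + 2 < r) :
    antiRamseyNumber (blowUp (completeGraph (Fin r)) t) (completeGraph (Fin (m + 2))) =
      t ^ 2 * extremalNumber r (completeGraph (Fin (m + 1))) + 1 := by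
  obtain ⟨c, hc⟩ := exists_isTuranColoring r m
  refine antiRamseyNumber_blowUp_eq (fun c hc => ?_) c (hc.not_hasRainbowCopy (by omega))
    (hc.numColors_blowUpColoring (by omega) (by omega))
  have hle := numColors_blowUpColoring_completeGraph_le (t := t) hm (by simpa) hc
  rwa [Fintype.card_fin] at hle

end TuranColorings

end AntiRamsey

theorem mainTheorem2 (r k t : ℕ) (hk : 4 ≤ k) (hkr : k ≤ r) (ht : 1 ≤ t) :
    (r = k →
      AntiRamsey.antiRamseyNumber (SimpleGraph.completeEquipartiteGraph r t)
          (SimpleGraph.completeGraph (Fin k))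
        = t ^ 2 * (k.choose 2 - 2) + t) ∧
    (k < r →
      AntiRamsey.antiRamseyNumber (SimpleGraph.completeEquipartiteGraph r t)
          (SimpleGraph.completeGraph (Fin k))
        = t ^ 2 * SimpleGraph.extremalNumber r (SimpleGraph.completeGraph (Fin (k - 1))) + 1 ∧
      (∃ c : (SimpleGraph.completeGraph (Fin r)).EdgeLabeling ℕ,
        AntiRamsey.IsTuranColoring (k - 2) c) ∧
      ∀ c : (SimpleGraph.completeGraph (Fin r)).EdgeLabeling ℕ,
        AntiRamsey.IsTuranColoring (k - 2) c →
          ¬ AntiRamsey.HasRainbowCopy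
              (G := SimpleGraph.completeEquipartiteGraph r t)
              (AntiRamsey.blowUpColoring c t) (SimpleGraph.completeGraph (Fin k)) ∧
          AntiRamsey.numColors
              (G := SimpleGraph.completeEquipartiteGraph r t)
              (AntiRamsey.blowUpColoring c t)
            = t ^ 2 * SimpleGraph.extremalNumber r (SimpleGraph.completeGraph (Fin (k - 1))) + 1) := by
  have : NeZero t := ⟨by omega⟩
  constructor
  · rintro rfl
    simpa using AntiRamsey.antiRamseyNumber_blowUp_completeGraph_self (V := Fin r) (t := t)
      (by rw [Fintype.card_fin]; omega)
  · intro hlt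
    obtain ⟨m, rfl⟩ : ∃ m, k = m + 2 := ⟨k - 2, by omega⟩
    simp only [Nat.add_sub_cancel]
    exact ⟨AntiRamsey.antiRamseyNumber_blowUp_completeGraph_of_lt (by omega) hlt,
      AntiRamsey.exists_isTuranColoring r m, fun c hc =>
      ⟨fun h => hc.not_hasRainbowCopy (by omega) h.of_blowUpColoring,
        hc.numColors_blowUpColoring (by omega) (by omega)⟩⟩
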